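/- Let $k$ be a perfect field of prime characteristic $p$, let $n\ge 1$, $R=k[[X_1,\dots,X_{n+1}]]$ and $\mathfrak m=(X_1,\dots,X_{n+1})$. For an ideal $I$ let $I^{[p^e]}$ be the ideal generated by the $p^e$-th powers of the elements of $I$. For $0\ne f\in\mathfrak m$ and integers $e,t\ge 0$ put $$M_{e,t}=\frac{(f^t)+\mathfrak m^{[p^e]}}{(f^{t+1})+\mathfrak m^{[p^e]}},\qquad C_{e,t}=\frac{\ell_R(M_{e,t})}{p^{en}},$$ where $\ell_R$ denotes length. For $x\in[0,1]$ put $\xi_{f,e}(x)=C_{e,\lfloor xp^e\rfloor}$ if $x<1$, $\xi_{f,e}(1)=C_{e,p^e-1}$, and $\xi_f(x)=\limsup_{e\to\infty}\xi_{f,e}(x)$. Let $\mathrm{fpt}(f)=\lim_{e\to\infty}\mu_f(p^e)/p^e$ with $\mu_f(p^e)=\min\{t\ge 1: f^t\in\mathfrak m^{[p^e]}\}$. For a $d$-dimensional complete Cohen–Macaulay F-finite local ring $S$ of characteristic $p$ let $F^e_*S$ be $S$ regarded as an $S$-module through the $e$-th iterate of Frobenius, write $F^e_*S\simeq S^{\oplus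 a_e}\oplus M_e$ where $M_e$ has no free direct summand, and let $s(S)=\lim_{e\to\infty}a_e/p^{ed}$ (the F-signature). Let $f=X_1^{\alpha_1}\cdots X_{n+1}^{\alpha_{n+1}}$ with integers $0\le\alpha_1\le\dots\le\alpha_{n+1}$ and $\alpha_{n+1}\ge 1$. Then: 1. The limit defining $\mathrm{fpt}(f)$ exists and $\mathrm{fpt}(f)=\frac1{\alpha_{n+1}}$. If $\alpha_{n+1}\ge 2$, the limit defining $s(R/(f))$ exists and $s(R/(f))=0$. 2. $\displaystyle\lim_{x\to\frac1{\alpha_{n+1}}-0}\xi_f(x)=\Big(\frac1{\alpha_{n+1}}\Big)^{n-1}\prod_{j=1}^n(\alpha_{n+1}-\alpha_j)\ \ge 0$. 3. If $f\ne X_{n+1}$, then $\xi_f$ is continuous on $[0,1]$ if and only if $\alpha_n=\alpha_{n+1}$. 4. Write $\alpha_{n+1}=p^sq$ with $s\ge 0$ and $q$ coprime to $p$. The limit $\displaystyle\lim_{e\to\infty}\xi_{f,e}\Big(\frac1{\alpha_{n+1}}\Big)$ exists if and only if $\alpha_n=\alpha_{n+1}$ or $p\equiv 1\pmod q$. -/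

import Mathlib

open Filter Topology

universe u

noncomputable section

/-! ### Frobenius pushforward, Frobenius splitting numbers and the F-signature -/

/-- The module `F^e_* S`: the additive group of `S`, on which `a : S` acts by
`a • s = a ^ (p ^ e) * s`. -/
def FrobeniusPushforward (_p _e : ℕ) (S : Type u) : Type u := S

instance (p e : ℕ) (S : Type u) [CommRing S] : AddCommGroup (FrobeniusPushforward p e S) :=
  inferInstanceAs (AddCommGroup S)

instance (p e : ℕ) [Fact p.Prime] (S : Type u) [CommRing S] [CharP S p] :
    Module S (FrobeniusPushforward p e S) :=
  Module.compHom S (iterateFrobenius S p e)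

theorem FrobeniusPushforward.smul_def (p e : ℕ) [Fact p.Prime] (S : Type u) [CommRing S]
    [CharP S p] (a : S) (s : FrobeniusPushforward p e S) :
    a • s = (a ^ p ^ e * (show S from s) : S) := rfl

/-- `M` has a free direct summand (equivalently, a summand isomorphic to `S` itself). -/
def HasFreeSummand (S M : Type u) [CommRing S] [AddCommGroup M] [Module S M] : Prop :=
  ∃ (N : Type u) (_ : AddCommGroup N) (_ : Module S N), Nonempty (M ≃ₗ[S] S × N)

/-- `a` is the `e`-th Frobenius splitting number of `S`: `F^e_* S ≃ S^a ⊕ M`, where `M` has no free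
direct summand. -/
def IsFrobeniusSplittingNumber (p e : ℕ) [Fact p.Prime] (S : Type u) [CommRing S] [CharP S p]
    (a : ℕ) : Prop :=
  ∃ (M : Type u) (_ : AddCommGroup M) (_ : Module S M),
    Nonempty (FrobeniusPushforward p e S ≃ₗ[S] (Fin a → S) × M) ∧ ¬ HasFreeSummand S M

/-- For a Noetherian local ring `S`: `S` has characteristic `p`, and its F-signature
`lim a_e / p ^ (e * d)` exists and equals `s`. Here `a_e` is the `e`-th Frobenius splitting number
and `d` is the Krull dimension of `S` (a natural number, as `S` is Noetherian and local). -/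
def HasFSignature (p : ℕ) [Fact p.Prime] (S : Type u) [CommRing S] (s : ℝ) : Prop :=
  ∃ _ : CharP S p, ∃ a : ℕ → ℕ, (∀ e, IsFrobeniusSplittingNumber p e S (a e)) ∧
    Tendsto (fun e : ℕ => (a e : ℝ) / (p : ℝ) ^ (e * ((ringKrullDim S).unbotD 0).toNat))
      atTop (𝓝 s)

/-! ### The function `ξ_f` of a hypersurface `f` in `k⟦X_1, …, X_{n+1}⟧` -/

/-- `I^{[q]}`: the ideal generated by the `q`-th powers of the elements of `I`. -/
def frobeniusPower {R : Type u} [CommRing R] (I : Ideal R) (q : ℕ) : Ideal R :=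
  Ideal.span ((fun x => x ^ q) '' (I : Set R))

/-- The maximal ideal `(X_1, …, X_{n+1})` of the power series ring. -/
def varIdeal (n : ℕ) (k : Type u) [Field k] : Ideal (MvPowerSeries (Fin (n + 1)) k) :=
  Ideal.span (Set.range MvPowerSeries.X)

section Xi

variable (p : ℕ) {n : ℕ} {k : Type u} [Field k] (f : MvPowerSeries (Fin (n + 1)) k)

/-- The ideal `(f^t) + 𝔪^{[p^e]}`. -/
def powIdeal (e t : ℕ) : Ideal (MvPowerSeries (Fin (n + 1)) k) :=
  Ideal.span {f ^ t} ⊔ frobeniusPower (varIdeal n k) (p ^ e)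

/-- `M_{e,t} = ((f^t) + 𝔪^{[p^e]}) / ((f^{t+1}) + 𝔪^{[p^e]})`. -/
abbrev hypersurfaceM (e t : ℕ) : Type u :=
  ↥(powIdeal p f e t) ⧸ (powIdeal p f e (t + 1)).submoduleOf (powIdeal p f e t)

/-- `C_{e,t} = ℓ_R(M_{e,t}) / p^{en}` (the length is finite, `M_{e,t}` being a subquotient of
`R / 𝔪^{[p^e]}`). -/
def hypersurfaceC (e t : ℕ) : ℝ :=
  ((Module.length (MvPowerSeries (Fin (n + 1)) k) (hypersurfaceM p f e t)).toNat : ℝ)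
    / (p : ℝ) ^ (e * n)

/-- `ξ_{f,e}`; only its values on `[0,1]` are meaningful. -/
def xiSeq (e : ℕ) (x : ℝ) : ℝ :=
  if x < 1 then hypersurfaceC p f e ⌊x * (p : ℝ) ^ e⌋₊ else hypersurfaceC p f e (p ^ e - 1)

/-- `ξ_f(x) = limsup_e ξ_{f,e}(x)`; only its values on `[0,1]` are meaningful. (For `f` in the
maximal ideal the sequence is bounded, so this is the usual upper limit.) -/
def xi (x : ℝ) : ℝ :=
  limsup (fun e : ℕ => xiSeq p f e x) atTop

/-- `μ_f(p^e) = min {t ≥ 1 | f^t ∈ 𝔪^{[p^e]}}` (the set contains `p^e` when `f ∈ 𝔪`). -/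
def muF (e : ℕ) : ℕ :=
  sInf {t : ℕ | 1 ≤ t ∧ f ^ t ∈ frobeniusPower (varIdeal n k) (p ^ e)}

/-- The F-pure threshold `fpt(f) = lim_e μ_f(p^e) / p^e` exists and equals `c`. -/
def HasFPT (c : ℝ) : Prop :=
  Tendsto (fun e : ℕ => (muF p f e : ℝ) / (p : ℝ) ^ e) atTop (𝓝 c)

end Xi

end

/-! ### Monomial ideals of power series rings and their colength -/

/-! Everything reduces to counting lattice points. Put `Q = p ^ e` and `a = α (Fin.last n)`. The
ideal `(f^t) + 𝔪^{[Q]}` is monomial, so its colength is the number of exponents in the box `[0,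
Q)^(n+1)` that are not `≥ t * α`, that is `Q^(n+1) - ∏ (Q - t * α i)` with truncated subtraction.
Hence `C_{e,t}` is the difference of two consecutive products divided by `Q^n`
(`hypersurfaceC_monomial`).

Let `t / Q → x`. If `x < 1/a`, nothing is truncated eventually, and the difference quotient tends to
minus the derivative of `∏ (1 - x * α i)` (`tendsto_xiSeq_of_lt`). If `x > 1/a`, both products
vanish eventually (`eventually_xiSeq_eq_zero`). So `ξ_f` can jump only at `1/a`, by the value
computed in `volumeDensity_inv_last`, which is zero exactly when some other exponent equals `a`. At
`x = 1/a` only the first product survives: `ξ_{f,e}` is the integer `Q - t * a` times a convergent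
product (`xiSeq_inv_last`). For `a ≥ 2` this integer is `Q % a`, and convergence becomes a question
about remainders of powers of `p`.

The threshold follows from `f^t ∈ 𝔪^{[Q]} ↔ Q ≤ t * a`. The F-signature vanishes because a nonzero
square-zero element of `R/(f)` kills `F^e_*` for `e ≥ 1`. -/

namespace MvPowerSeries

variable {σ : Type*} {k : Type*}

/-- A power series lies in the ideal generated by finitely many monomials if and only if all its
exponents are divisible by one of them. -/
theorem mem_span_monomial_iff [CommRing k] (T : Finset (σ →₀ ℕ)) (g : MvPowerSeries σ k) :
    g ∈ Ideal.span ((fun γ => monomial γ (1 : k)) '' (T : Set (σ →₀ ℕ))) ↔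
      ∀ β, (∀ γ ∈ T, ¬ γ ≤ β) → coeff β g = 0 := by
  classical
  constructor
  · intro hg β hβ
    induction hg using Submodule.span_induction generalizing β with
    | mem x hx =>
      obtain ⟨γ, hγ, rfl⟩ := hx
      rw [coeff_monomial, if_neg]
      rintro rfl
      exact hβ _ hγ le_rfl
    | zero => simp
    | add x y _ _ hx hy => simp [hx β hβ, hy β hβ]
    | smul a x _ hx =>
      rw [smul_eq_mul, coeff_mul]
      refine Finset.sum_eq_zero fun c hc => ?_
      have hle : c.2 ≤ β := by
        rw [← Finset.HasAntidiagonal.mem_antidiagonal.1 hc]; exact le_add_self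
      rw [hx c.2 fun γ hγ h => hβ γ hγ (h.trans hle), mul_zero]
  · induction T using Finset.induction_on generalizing g with
    | empty =>
      intro h
      have : g = 0 := by ext β; simpa using h β (by simp)
      simp [this]
    | insert γ T _ ih =>
      intro h
      -- The terms of `g` divisible by `γ`, shifted down by `γ`; subtracting `q * monomial γ 1`
      -- removes exactly these terms.
      let q : MvPowerSeries σ k := fun β => coeff (β + γ) g
      have hrest : g - q * monomial γ 1 ∈
          Ideal.span ((fun γ => monomial γ (1 : k)) '' (T : Set (σ →₀ ℕ))) := by
        refine ih _ fun β hβ => ?_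
        rw [map_sub, mul_comm, coeff_monomial_mul]
        split_ifs with hle
        · have : coeff (β - γ) q = coeff β g := by
            change coeff (β - γ + γ) g = _
            rw [tsub_add_cancel_of_le hle]
          rw [this]; ring
        · rw [h β, sub_zero]
          intro δ hδ
          rcases Finset.mem_insert.1 hδ with rfl | hδ
          exacts [hle, hβ δ hδ]
      have hsub : Ideal.span ((fun γ => monomial γ (1 : k)) '' (T : Set (σ →₀ ℕ))) ≤
          Ideal.span ((fun γ => monomial γ (1 : k)) '' ((insert γ T : Finset _) : Set (σ →₀ ℕ))) :=
        Ideal.span_mono (Set.image_mono (by simp))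
      have hmem : q * monomial γ 1 ∈
          Ideal.span ((fun γ => monomial γ (1 : k)) '' ((insert γ T : Finset _) : Set (σ →₀ ℕ))) :=
        Ideal.mul_mem_left _ _ (Ideal.subset_span ⟨γ, by simp, rfl⟩)
      simpa using add_mem (hsub hrest) hmem

theorem prod_X_pow_eq_monomial [Fintype σ] [CommRing k] (α : σ → ℕ) :
    ∏ i, X i ^ α i = monomial (Finsupp.equivFunOnFinite.symm α) (1 : k) := by
  classical
  have h := monomial_eq (R := k) (Finsupp.equivFunOnFinite.symm α) (fun _ => 1)
  simp only [one_pow, one_smul] at h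
  have h' := Finsupp.prod_fintype (Finsupp.equivFunOnFinite.symm α)
    (fun s e => (X s : MvPowerSeries σ k) ^ e) (fun _ => pow_zero _)
  rw [h'] at h
  simpa [Finsupp.prod] using h.symm

/-- The ideal of power series whose coefficients vanish on the lower set `D`. -/
def vanishingIdeal [CommRing k] (D : Set (σ →₀ ℕ)) (hD : IsLowerSet D) :
    Ideal (MvPowerSeries σ k) where
  carrier := {g | ∀ β ∈ D, coeff β g = 0}
  add_mem' hx hy β hβ := by simp [hx β hβ, hy β hβ]
  zero_mem' β _ := by simp
  smul_mem' a x hx β hβ := by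
    classical
    rw [smul_eq_mul, coeff_mul]
    refine Finset.sum_eq_zero fun c hc => ?_
    have hle : c.2 ≤ β := by
      rw [← Finset.HasAntidiagonal.mem_antidiagonal.1 hc]; exact le_add_self
    rw [hx c.2 (hD hle hβ), mul_zero]

theorem mem_vanishingIdeal [CommRing k] {D : Set (σ →₀ ℕ)} {hD : IsLowerSet D}
    {g : MvPowerSeries σ k} : g ∈ vanishingIdeal D hD ↔ ∀ β ∈ D, coeff β g = 0 := Iff.rfl

end MvPowerSeries

/-- Additivity of length along `0 → I/J → M/J → M/I → 0`. It serves both to compute colengths one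
exponent at a time and to write `ℓ(M_{e,t})` as a difference of colengths. -/
theorem Submodule.length_quotient_eq_add {R M : Type*} [Ring R] [AddCommGroup M] [Module R M]
    {J I : Submodule R M} (h : J ≤ I) :
    Module.length R (M ⧸ J) = Module.length R (I ⧸ J.comap I.subtype) + Module.length R (M ⧸ I) := by
  refine Module.length_eq_add_of_exact ((J.comap I.subtype).mapQ J I.subtype le_rfl)
    (Submodule.factor h) ?_ (Submodule.factor_surjective h) ?_
  · rw [← LinearMap.ker_eq_bot, Submodule.ker_mapQ]
    exact Submodule.mkQ_map_self _
  · rw [LinearMap.exact_iff]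
    ext x
    obtain ⟨x, rfl⟩ := J.mkQ_surjective x
    rw [LinearMap.mem_ker, LinearMap.mem_range]
    change (Submodule.Quotient.mk x : M ⧸ I) = 0 ↔ _
    rw [Submodule.Quotient.mk_eq_zero]
    constructor
    · intro hx
      exact ⟨Submodule.Quotient.mk ⟨x, hx⟩, rfl⟩
    · rintro ⟨y, hy⟩
      obtain ⟨y, rfl⟩ := Submodule.mkQ_surjective _ y
      have : (y : M) - x ∈ J := (Submodule.Quotient.eq J).1 hy
      simpa using sub_mem y.2 (h this)

namespace MvPowerSeries

variable {σ : Type*} {k : Type*} [Field k]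

/-- The two ideals differ by the single condition on the coefficient at `β`. An element violating it
can be scaled by a constant to correct any other element. -/
theorem vanishingIdeal_covBy {D : Set (σ →₀ ℕ)} {β : σ →₀ ℕ} (hβ : β ∉ D) (hD : IsLowerSet D)
    (hD' : IsLowerSet (insert β D)) :
    vanishingIdeal (k := k) (insert β D) hD' ⋖ vanishingIdeal D hD := by
  classical
  refine ⟨lt_of_le_of_ne (fun g hg γ hγ => hg γ (Set.mem_insert_of_mem _ hγ)) ?_, ?_⟩
  · intro h
    have hm : monomial β (1 : k) ∈ vanishingIdeal D hD := by
      intro γ hγ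
      rw [coeff_monomial, if_neg (by rintro rfl; exact hβ hγ)]
    rw [← h] at hm
    simpa using hm β (Set.mem_insert _ _)
  · intro C hC hCD
    obtain ⟨hle, g, hgC, hg⟩ := SetLike.lt_iff_le_and_exists.1 hC
    refine hCD.not_ge fun h hh => ?_
    have hgβ : coeff β g ≠ 0 := by
      intro h0
      apply hg
      rintro γ (rfl | hγ)
      exacts [h0, hCD.le hgC γ hγ]
    have hdiff : h - MvPowerSeries.C (coeff β h / coeff β g) * g ∈
        vanishingIdeal (insert β D) hD' := by
      rintro γ (rfl | hγ)
      · simp [hgβ]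
      · simp [hh γ hγ, hCD.le hgC γ hγ]
    simpa using add_mem (hle hdiff) (C.mul_mem_left (MvPowerSeries.C (coeff β h / coeff β g)) hgC)

/-- The colength of the ideal of power series vanishing on a finite lower set of exponents. -/
theorem length_quotient_vanishingIdeal (D : Finset (σ →₀ ℕ))
    (hD : IsLowerSet (D : Set (σ →₀ ℕ))) :
    Module.length (MvPowerSeries σ k)
      (MvPowerSeries σ k ⧸ vanishingIdeal (k := k) (D : Set (σ →₀ ℕ)) hD) = D.card := by
  classical
  induction hn : D.card generalizing D with
  | zero =>
    obtain rfl := Finset.card_eq_zero.1 hn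
    have : vanishingIdeal (k := k) ((∅ : Finset (σ →₀ ℕ)) : Set (σ →₀ ℕ)) hD = ⊤ :=
      (Ideal.eq_top_iff_one _).2 fun γ hγ => (Finset.notMem_empty γ (Finset.mem_coe.1 hγ)).elim
    rw [Nat.cast_zero, Module.length_eq_zero_iff]
    exact Submodule.Quotient.subsingleton_iff.2 this
  | succ m ih =>
    have hne : D.Nonempty := Finset.card_pos.1 (by omega)
    -- Maximality of `β` keeps `D.erase β` a lower set.
    obtain ⟨β, hβ⟩ := D.exists_maximal hne
    have hlow : IsLowerSet ((D.erase β : Finset (σ →₀ ℕ)) : Set (σ →₀ ℕ)) := by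
      intro a b hba ha
      have ha' := Finset.mem_erase.1 (Finset.mem_coe.1 ha)
      refine Finset.mem_coe.2 (Finset.mem_erase.2 ⟨?_, hD hba ha'.2⟩)
      rintro rfl
      exact ha'.1 (le_antisymm (hβ.2 ha'.2 hba) hba)
    have hins : insert β ((D.erase β : Finset (σ →₀ ℕ)) : Set (σ →₀ ℕ)) = D := by
      rw [← Finset.coe_insert, Finset.insert_erase hβ.1]
    have hcov : vanishingIdeal (k := k) (D : Set (σ →₀ ℕ)) hD ⋖ vanishingIdeal _ hlow := by
      have := vanishingIdeal_covBy (k := k) (by simp) hlow (β := β) (hins ▸ hD)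
      simpa only [hins] using this
    rw [Submodule.length_quotient_eq_add hcov.le,
      ih _ hlow (by rw [Finset.card_erase_of_mem hβ.1, hn]; rfl),
      Module.length_eq_one_iff.2 ((covBy_iff_quot_is_simple hcov.le).1 hcov)]
    push_cast
    ring

end MvPowerSeries

/-! ### The lengths and thresholds attached to a monomial -/

/-- Additivity of Frobenius makes the powers of the generators sufficient. -/
theorem frobeniusPower_span_range {ι : Type*} {R : Type*} [CommRing R] {p : ℕ} [Fact p.Prime]
    [CharP R p] (x : ι → R) (e : ℕ) :
    frobeniusPower (Ideal.span (Set.range x)) (p ^ e) =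
      Ideal.span (Set.range fun i => x i ^ p ^ e) := by
  refine le_antisymm (Ideal.span_le.2 ?_) (Ideal.span_le.2 ?_)
  · rintro _ ⟨y, hy, rfl⟩
    change y ^ p ^ e ∈ _
    induction hy using Submodule.span_induction with
    | mem y hy =>
      obtain ⟨i, rfl⟩ := hy
      exact Ideal.subset_span ⟨i, rfl⟩
    | zero =>
      rw [zero_pow (pow_ne_zero _ (Fact.out : p.Prime).ne_zero)]
      exact zero_mem _
    | add y z _ _ hy hz =>
      rw [add_pow_char_pow]
      exact add_mem hy hz
    | smul a y _ hy =>
      rw [smul_eq_mul, mul_pow]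
      exact Ideal.mul_mem_left _ _ hy
  · rintro _ ⟨i, rfl⟩
    exact Ideal.subset_span ⟨x i, Ideal.subset_span ⟨i, rfl⟩, rfl⟩

theorem charP_mvPowerSeries (p : ℕ) (σ k : Type*) [Field k] [CharP k p] :
    CharP (MvPowerSeries σ k) p :=
  charP_of_injective_algebraMap (algebraMap k (MvPowerSeries σ k)).injective p

section Monomial

variable {p : ℕ} [Fact p.Prime] {k : Type u} [Field k] [CharP k p] {n : ℕ}

/-- The exponents of the generators of `𝔪^{[q]}`. -/
noncomputable def frobeniusExponents (n q : ℕ) : Finset (Fin (n + 1) →₀ ℕ) :=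
  Finset.univ.image fun i => Finsupp.single i q

theorem frobeniusPower_varIdeal (e : ℕ) :
    frobeniusPower (varIdeal n k) (p ^ e) =
      Ideal.span ((fun γ => MvPowerSeries.monomial γ (1 : k)) ''
        (frobeniusExponents n (p ^ e) : Set (Fin (n + 1) →₀ ℕ))) := by
  have := charP_mvPowerSeries p (Fin (n + 1)) k
  rw [varIdeal, frobeniusPower_span_range, frobeniusExponents]
  congr 1
  simp only [Finset.coe_image, Finset.coe_univ, Set.image_univ, ← Set.range_comp]
  congr 1
  funext i
  exact MvPowerSeries.X_pow_eq i _

theorem monomial_pow_eq (α : Fin (n + 1) → ℕ) (t : ℕ) :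
    (∏ i, (MvPowerSeries.X i : MvPowerSeries (Fin (n + 1)) k) ^ α i) ^ t =
      MvPowerSeries.monomial (Finsupp.equivFunOnFinite.symm fun i => t * α i) (1 : k) := by
  rw [← MvPowerSeries.prod_X_pow_eq_monomial, ← Finset.prod_pow]
  exact Finset.prod_congr rfl fun i _ => by rw [← pow_mul, mul_comm]

theorem pow_mem_frobeniusPower_iff (α : Fin (n + 1) → ℕ) (e t : ℕ) :
    (∏ i, (MvPowerSeries.X i : MvPowerSeries (Fin (n + 1)) k) ^ α i) ^ t ∈
      frobeniusPower (varIdeal n k) (p ^ e) ↔ ∃ i, p ^ e ≤ t * α i := by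
  classical
  rw [frobeniusPower_varIdeal, monomial_pow_eq, MvPowerSeries.mem_span_monomial_iff]
  have hsingle : ∀ i, Finsupp.single i (p ^ e) ≤
      (Finsupp.equivFunOnFinite.symm fun i => t * α i : Fin (n + 1) →₀ ℕ) ↔ p ^ e ≤ t * α i := by
    intro i
    rw [Finsupp.single_le_iff]; rfl
  constructor
  · intro h
    by_contra! hc
    have := h (Finsupp.equivFunOnFinite.symm fun i => t * α i) (by
      intro γ hγ
      obtain ⟨i, -, rfl⟩ := Finset.mem_image.1 hγ
      rw [hsingle]
      exact (hc i).not_ge)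
    simp at this
  · rintro ⟨i, hi⟩ β hβ
    rw [MvPowerSeries.coeff_monomial, if_neg]
    rintro rfl
    exact hβ _ (Finset.mem_image.2 ⟨i, Finset.mem_univ i, rfl⟩) ((hsingle i).2 hi)

/-- The exponents `β` with `a i ≤ β i < q` for all `i`. -/
noncomputable def exponentBox (n q : ℕ) (a : Fin (n + 1) → ℕ) : Finset (Fin (n + 1) →₀ ℕ) :=
  (Fintype.piFinset fun i => Finset.Ico (a i) q).map
    (Finsupp.equivFunOnFinite.symm : (Fin (n + 1) → ℕ) ≃ (Fin (n + 1) →₀ ℕ)).toEmbedding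

theorem mem_exponentBox {q : ℕ} {a : Fin (n + 1) → ℕ} {β : Fin (n + 1) →₀ ℕ} :
    β ∈ exponentBox n q a ↔ ∀ i, a i ≤ β i ∧ β i < q := by
  simp only [exponentBox, Finset.mem_map_equiv, Fintype.mem_piFinset, Finset.mem_Ico]
  rfl

theorem card_exponentBox (q : ℕ) (a : Fin (n + 1) → ℕ) :
    (exponentBox n q a).card = ∏ i, (q - a i) := by
  simp [exponentBox, Fintype.card_piFinset]

/-- The exponents in the box `[0, q)` that are not divisible by `a`. -/
noncomputable def standardExponents (n q : ℕ) (a : Fin (n + 1) → ℕ) : Finset (Fin (n + 1) →₀ ℕ) :=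
  exponentBox n q 0 \ exponentBox n q a

theorem mem_standardExponents {q : ℕ} {a : Fin (n + 1) → ℕ} {β : Fin (n + 1) →₀ ℕ} :
    β ∈ standardExponents n q a ↔ (∀ i, β i < q) ∧ ¬ ∀ i, a i ≤ β i := by
  simp only [standardExponents, Finset.mem_sdiff, mem_exponentBox, Pi.zero_apply, zero_le,
    true_and, forall_and]
  tauto

theorem isLowerSet_standardExponents (q : ℕ) (a : Fin (n + 1) → ℕ) :
    IsLowerSet (standardExponents n q a : Set (Fin (n + 1) →₀ ℕ)) := by
  intro β γ hle hβ
  have hβ := mem_standardExponents.1 (Finset.mem_coe.1 hβ)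
  exact Finset.mem_coe.2 (mem_standardExponents.2 ⟨fun i => (hle i).trans_lt (hβ.1 i),
    fun h => hβ.2 fun i => (h i).trans (hle i)⟩)

theorem card_standardExponents_add (q : ℕ) (a : Fin (n + 1) → ℕ) :
    (standardExponents n q a).card + ∏ i, (q - a i) = q ^ (n + 1) := by
  have hsub : exponentBox n q a ⊆ exponentBox n q 0 := fun β hβ =>
    mem_exponentBox.2 fun i => ⟨Nat.zero_le _, (mem_exponentBox.1 hβ i).2⟩
  rw [standardExponents, ← card_exponentBox, Finset.card_sdiff_add_card_eq_card hsub,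
    card_exponentBox]
  simp

/-- An exponent avoids all generators iff it lies in the box (no `X_i^{p^e}` divides it) and is not
above `t * α`. -/
theorem powIdeal_monomial (α : Fin (n + 1) → ℕ) (e t : ℕ) :
    powIdeal p (∏ i, (MvPowerSeries.X i : MvPowerSeries (Fin (n + 1)) k) ^ α i) e t =
      MvPowerSeries.vanishingIdeal _
        (isLowerSet_standardExponents (p ^ e) fun i => t * α i) := by
  classical
  rw [powIdeal, frobeniusPower_varIdeal, monomial_pow_eq, ← Ideal.span_union, ← Set.image_singleton
    (f := fun γ => MvPowerSeries.monomial γ (1 : k)), ← Set.image_union, ← Finset.coe_singleton,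
    ← Finset.coe_union]
  ext g
  rw [MvPowerSeries.mem_span_monomial_iff, MvPowerSeries.mem_vanishingIdeal]
  refine forall_congr' fun β => imp_congr_left ?_
  rw [Finset.mem_coe, mem_standardExponents]
  simp only [Finset.mem_union, Finset.mem_singleton, frobeniusExponents, Finset.mem_image,
    Finset.mem_univ, true_and, or_imp, forall_and, forall_eq, forall_exists_index,
    forall_apply_eq_imp_iff, Finsupp.single_le_iff, not_le]
  rw [and_comm]
  rfl

/-- The difference of two colengths. The factors use subtraction in `ℕ`, so a product vanishes once
one variable is exhausted. -/
theorem hypersurfaceC_monomial (α : Fin (n + 1) → ℕ) (e t : ℕ) :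
    hypersurfaceC p (∏ i, (MvPowerSeries.X i : MvPowerSeries (Fin (n + 1)) k) ^ α i) e t =
      ((∏ i, (p ^ e - t * α i) : ℕ) - (∏ i, (p ^ e - (t + 1) * α i) : ℕ) : ℝ) / (p : ℝ) ^ (e * n)
      := by
  set f : MvPowerSeries (Fin (n + 1)) k := ∏ i, MvPowerSeries.X i ^ α i with hf
  have hlen : ∀ t, Module.length (MvPowerSeries (Fin (n + 1)) k)
      (MvPowerSeries (Fin (n + 1)) k ⧸ powIdeal p f e t) =
        (standardExponents n (p ^ e) fun i => t * α i).card := fun t => by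
    rw [hf, powIdeal_monomial]
    exact MvPowerSeries.length_quotient_vanishingIdeal _ _
  have hle : powIdeal p f e (t + 1) ≤ powIdeal p f e t := by
    refine sup_le_sup_right ((Ideal.span_singleton_le_span_singleton).2 ?_) _
    exact pow_dvd_pow f (Nat.le_succ t)
  have hadd : ((standardExponents n (p ^ e) fun i => (t + 1) * α i).card : ℕ∞) =
      Module.length (MvPowerSeries (Fin (n + 1)) k) (hypersurfaceM p f e t) +
        (standardExponents n (p ^ e) fun i => t * α i).card := by
    rw [← hlen, ← hlen]
    exact Submodule.length_quotient_eq_add hle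
  -- Finiteness ensures that `toNat` in `hypersurfaceC` loses nothing.
  have hfin : Module.length (MvPowerSeries (Fin (n + 1)) k) (hypersurfaceM p f e t) ≠ ⊤ := by
    intro h
    rw [h, top_add] at hadd
    exact ENat.natCast_ne_top _ hadd
  rw [hypersurfaceC]
  obtain ⟨m, hm⟩ := ENat.ne_top_iff_exists.1 hfin
  rw [← hm] at hadd ⊢
  have hadd' : (standardExponents n (p ^ e) fun i => (t + 1) * α i).card =
    m + (standardExponents n (p ^ e) fun i => t * α i).card := by exact_mod_cast hadd
  have h1 := card_standardExponents_add (p ^ e) fun i => t * α i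
  have h2 := card_standardExponents_add (p ^ e) fun i => (t + 1) * α i
  have h3 : m + ∏ i, (p ^ e - (t + 1) * α i) = ∏ i, (p ^ e - t * α i) := by omega
  rw [← h3, ENat.toNat_natCast]
  push_cast
  ring

end Monomial

/-! ### The asymptotics of the normalized lengths -/

section Asymptotics

/-- The index `t` with `xiSeq p f e x = hypersurfaceC p f e t`. -/
noncomputable def xiIndex (p e : ℕ) (x : ℝ) : ℕ := if x < 1 then ⌊x * (p : ℝ) ^ e⌋₊ else p ^ e - 1

theorem xiSeq_eq_hypersurfaceC (p : ℕ) {n : ℕ} {k : Type u} [Field k]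
    (f : MvPowerSeries (Fin (n + 1)) k) (e : ℕ) (x : ℝ) :
    xiSeq p f e x = hypersurfaceC p f e (xiIndex p e x) := by
  unfold xiSeq xiIndex
  split_ifs <;> rfl

variable {n : ℕ}

/-- Minus the derivative of `∏ i, (1 - x * α i)`, in telescoped form. -/
noncomputable def volumeDensity (α : Fin (n + 1) → ℕ) (x : ℝ) : ℝ :=
  ∑ i, ((α i : ℝ) * ∏ j with j < i, (1 - x * α j)) * ∏ j with i < j, (1 - x * α j)

theorem continuous_volumeDensity (α : Fin (n + 1) → ℕ) : Continuous (volumeDensity α) := by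
  unfold volumeDensity
  fun_prop

/-- An exact telescoping identity: after division by `h`, the limit can be taken factor by factor
even though `y` moves with `e`. -/
theorem prod_sub_prod_eq (α : Fin (n + 1) → ℕ) (y h : ℝ) :
    ∏ i, (1 - y * α i) - ∏ i, (1 - (y + h) * α i) =
      h * ∑ i, ((α i : ℝ) * ∏ j with j < i, (1 - y * α j)) *
        ∏ j with i < j, (1 - (y + h) * α j) := by
  have hs : ∀ i, (1 - y * α i) = (1 - (y + h) * α i) + h * α i := fun i => by ring
  have key := Finset.prod_add_ordered Finset.univ (fun i => 1 - (y + h) * (α i : ℝ))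
    (fun i => h * (α i : ℝ))
  simp only [← hs] at key
  rw [key, add_sub_cancel_left, Finset.mul_sum]
  exact Finset.sum_congr rfl fun i _ => by ring

/-- Each summand except the last contains the factor `1 - a/a = 0`. -/
theorem volumeDensity_inv_last (α : Fin (n + 1) → ℕ) (hpos : 1 ≤ α (Fin.last n)) (hn : 1 ≤ n) :
    volumeDensity α (1 / (α (Fin.last n) : ℝ)) = (1 / (α (Fin.last n) : ℝ)) ^ (n - 1) *
        ∏ j : Fin n, ((α (Fin.last n) : ℝ) - (α j.castSucc : ℝ)) := by
  have ha : (α (Fin.last n) : ℝ) ≠ 0 := by positivity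
  rw [volumeDensity, Finset.sum_eq_single (Fin.last n)]
  · have h1 : (Finset.univ.filter fun j => Fin.last n < j) = ∅ := by
      ext j; simp [Fin.le_last]
    have h2 : (Finset.univ.filter fun j => j < Fin.last n) =
        Finset.univ.map Fin.castSuccEmb := by
      ext j
      simp only [Finset.mem_filter, Finset.mem_univ, true_and, Finset.mem_map, Fin.castSuccEmb_apply,
        Fin.lt_last_iff_ne_last, Fin.exists_castSucc_eq]
    rw [h1, h2, Finset.prod_map, Finset.prod_empty, mul_one]
    have h3 : ∀ j : Fin n, 1 - 1 / (α (Fin.last n) : ℝ) * (α j.castSucc : ℝ) =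
        ((α (Fin.last n) : ℝ) - (α j.castSucc : ℝ)) * (1 / (α (Fin.last n) : ℝ)) := fun j => by
      field_simp
    simp only [Fin.castSuccEmb_apply, h3, Finset.prod_mul_distrib, Finset.prod_const,
      Finset.card_univ, Fintype.card_fin]
    obtain ⟨m, rfl⟩ := Nat.exists_eq_add_of_le' hn
    rw [Nat.add_sub_cancel, pow_succ]
    field_simp
  · intro i _ hi
    have hz : ∏ j with i < j, (1 - 1 / (α (Fin.last n) : ℝ) * α j) = 0 :=
      Finset.prod_eq_zero (i := Fin.last n)
        (Finset.mem_filter.2 ⟨Finset.mem_univ _, Fin.lt_last_iff_ne_last.2 hi⟩)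
        (by field_simp; ring)
    rw [hz, mul_zero]
  · simp

variable {p : ℕ} [Fact p.Prime]

theorem tendsto_prime_pow_atTop : Tendsto (fun e : ℕ => (p : ℝ) ^ e) atTop atTop :=
  tendsto_pow_atTop_atTop_of_one_lt (by exact_mod_cast (Fact.out : p.Prime).one_lt)

theorem prime_pow_pos (e : ℕ) : 0 < (p : ℝ) ^ e :=
  pow_pos (by exact_mod_cast (Fact.out : p.Prime).pos) e

theorem tendsto_one_div_prime_pow : Tendsto (fun e : ℕ => 1 / (p : ℝ) ^ e) atTop (𝓝 0) := by
  simp only [one_div]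
  exact (tendsto_prime_pow_atTop (p := p)).inv_tendsto_atTop

theorem tendsto_xiIndex_div {x : ℝ} (hx0 : 0 ≤ x) (hx1 : x ≤ 1) :
    Tendsto (fun e : ℕ => (xiIndex p e x : ℝ) / (p : ℝ) ^ e) atTop (𝓝 x) := by
  by_cases hx : x < 1
  · simp only [xiIndex, if_pos hx]
    exact (tendsto_nat_floor_mul_div_atTop hx0).comp tendsto_prime_pow_atTop
  · obtain rfl : x = 1 := le_antisymm hx1 (not_lt.1 hx)
    have h : ∀ e : ℕ, ((xiIndex p e 1 : ℕ) : ℝ) / (p : ℝ) ^ e = 1 - 1 / (p : ℝ) ^ e := fun e => by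
      have := (prime_pow_pos (p := p) e).ne'
      rw [xiIndex, if_neg hx, Nat.cast_sub (Nat.one_le_pow _ _ (Fact.out : p.Prime).pos)]
      push_cast
      field_simp
    simp only [h]
    simpa using (tendsto_const_nhds (x := (1 : ℝ))).sub (tendsto_one_div_prime_pow (p := p))

theorem cast_prod_sub {ι : Type*} [Fintype ι] (α : ι → ℕ) {e t : ℕ} (h : ∀ i, t * α i ≤ p ^ e) :
    ((∏ i, (p ^ e - t * α i) : ℕ) : ℝ) =
      ((p : ℝ) ^ e) ^ (Fintype.card ι) * ∏ i, (1 - (t : ℝ) / (p : ℝ) ^ e * α i) := by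
  have := (prime_pow_pos (p := p) e).ne'
  rw [← Finset.card_univ, ← Finset.prod_const, ← Finset.prod_mul_distrib, Nat.cast_prod]
  refine Finset.prod_congr rfl fun i _ => ?_
  rw [Nat.cast_sub (h i)]
  push_cast
  field_simp

/-! ### Limits of `ξ_{f,e}` below, above and at `1/a` -/

section Exponents

variable {k : Type u} [Field k] [CharP k p] {α : Fin (n + 1) → ℕ}

theorem tendsto_xiSeq_of_lt (hα : Monotone α) (hpos : 1 ≤ α (Fin.last n)) {x : ℝ} (hx0 : 0 ≤ x)
    (hx : x < 1 / (α (Fin.last n) : ℝ)) :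
    Tendsto (fun e : ℕ => xiSeq p (∏ i, (MvPowerSeries.X i : MvPowerSeries (Fin (n + 1)) k) ^ α i)
      e x) atTop (𝓝 (volumeDensity α x)) := by
  have ha : (0 : ℝ) < α (Fin.last n) := by exact_mod_cast hpos
  have hx1 : x ≤ 1 := hx.le.trans (by
    rw [div_le_one ha]; exact_mod_cast hpos)
  have hy := tendsto_xiIndex_div (p := p) hx0 hx1
  have hz := hy.add (tendsto_one_div_prime_pow (p := p))
  rw [add_zero] at hz
  have hlim : Tendsto (fun e : ℕ => ∑ i, ((α i : ℝ) *
      ∏ j with j < i, (1 - (xiIndex p e x : ℝ) / (p : ℝ) ^ e * α j)) *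
        ∏ j with i < j, (1 - ((xiIndex p e x : ℝ) / (p : ℝ) ^ e + 1 / (p : ℝ) ^ e) * α j))
      atTop (𝓝 (volumeDensity α x)) := by
    refine tendsto_finsetSum _ fun i _ => (tendsto_const_nhds.mul ?_).mul ?_
    · exact tendsto_finsetProd _ fun j _ => tendsto_const_nhds.sub (hy.mul_const _)
    · exact tendsto_finsetProd _ fun j _ => tendsto_const_nhds.sub (hz.mul_const _)
  refine hlim.congr' ?_
  -- Eventually `(t + 1) / p^e < 1/a`, so no subtraction in either product is truncated.
  filter_upwards [hz.eventually_lt_const hx] with e he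
  have hq := prime_pow_pos (p := p) e
  rw [xiSeq_eq_hypersurfaceC, hypersurfaceC_monomial]
  set t := xiIndex p e x
  have h1 : (t + 1) * α (Fin.last n) ≤ p ^ e := by
    rw [← add_div, lt_div_iff₀ ha, div_mul_eq_mul_div, div_lt_one hq] at he
    exact_mod_cast he.le
  have h2 : ∀ i, (t + 1) * α i ≤ p ^ e := fun i =>
    (Nat.mul_le_mul_left _ (hα (Fin.le_last i))).trans h1
  have h3 : ∀ i, t * α i ≤ p ^ e := fun i =>
    (Nat.mul_le_mul_right _ (Nat.le_succ t)).trans (h2 i)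
  rw [cast_prod_sub α h3, cast_prod_sub α h2, ← mul_sub]
  push_cast
  rw [add_div, prod_sub_prod_eq, Fintype.card_fin, pow_mul, pow_succ]
  field_simp

theorem eventually_xiSeq_eq_zero (hpos : 1 ≤ α (Fin.last n)) {x : ℝ}
    (hx : 1 / (α (Fin.last n) : ℝ) < x) (hx1 : x ≤ 1) :
    ∀ᶠ e : ℕ in atTop,
      xiSeq p (∏ i, (MvPowerSeries.X i : MvPowerSeries (Fin (n + 1)) k) ^ α i) e x = 0 := by
  have ha : (0 : ℝ) < α (Fin.last n) := by exact_mod_cast hpos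
  have hx0 : 0 ≤ x := (one_div_pos.2 ha).le.trans hx.le
  filter_upwards [(tendsto_xiIndex_div (p := p) hx0 hx1).eventually_const_lt hx] with e he
  have hq := prime_pow_pos (p := p) e
  rw [xiSeq_eq_hypersurfaceC, hypersurfaceC_monomial]
  set t := xiIndex p e x
  have h1 : p ^ e ≤ t * α (Fin.last n) := by
    rw [div_lt_iff₀ ha, div_mul_eq_mul_div, one_lt_div hq] at he
    exact_mod_cast he.le
  have h2 : p ^ e ≤ (t + 1) * α (Fin.last n) :=
    h1.trans (Nat.mul_le_mul_right _ (Nat.le_succ t))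
  rw [Finset.prod_eq_zero (Finset.mem_univ (Fin.last n)) (Nat.sub_eq_zero_of_le h1),
    Finset.prod_eq_zero (Finset.mem_univ (Fin.last n)) (Nat.sub_eq_zero_of_le h2)]
  simp

/-- For `a ≥ 2` the index is the floor of `p^e / a`. For `a = 1` the point is `x = 1`, where the
index is `p^e - 1` and the upper bound is an equality. -/
theorem xiIndex_inv_last_bounds (hpos : 1 ≤ α (Fin.last n)) (e : ℕ) :
    xiIndex p e (1 / (α (Fin.last n) : ℝ)) * α (Fin.last n) ≤ p ^ e ∧
      p ^ e ≤ (xiIndex p e (1 / (α (Fin.last n) : ℝ)) + 1) * α (Fin.last n) := by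
  rcases hpos.eq_or_lt with h | h
  · have := Nat.one_le_pow e _ (Fact.out : p.Prime).pos
    simp only [xiIndex, ← h]
    norm_num
    omega
  · have hlt : 1 / (α (Fin.last n) : ℝ) < 1 := by
      rw [div_lt_one (by positivity)]; exact_mod_cast h
    have hfl : xiIndex p e (1 / (α (Fin.last n) : ℝ)) = p ^ e / α (Fin.last n) := by
      rw [xiIndex, if_pos hlt, div_mul_eq_mul_div, one_mul, ← Nat.cast_pow, Nat.floor_div_eq_div]
    rw [hfl]
    refine ⟨Nat.div_mul_le_self _ _, ?_⟩
    rw [mul_comm]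
    exact (Nat.lt_mul_div_succ _ hpos).le

/-- The product at `t + 1` vanishes. In the product at `t`, the `n` powers of `p^e` in the
denominator normalize all factors but the last, which stays an integer. -/
theorem xiSeq_inv_last (hα : Monotone α) (hpos : 1 ≤ α (Fin.last n)) (e : ℕ) :
    xiSeq p (∏ i, (MvPowerSeries.X i : MvPowerSeries (Fin (n + 1)) k) ^ α i) e
        (1 / (α (Fin.last n) : ℝ)) =
      ((p ^ e - xiIndex p e (1 / (α (Fin.last n) : ℝ)) * α (Fin.last n) : ℕ) : ℝ) *
        ∏ j : Fin n, (1 - (xiIndex p e (1 / (α (Fin.last n) : ℝ)) : ℝ) / (p : ℝ) ^ e *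
          α j.castSucc) := by
  obtain ⟨h1, h2⟩ := xiIndex_inv_last_bounds (p := p) hpos e
  have hq := prime_pow_pos (p := p) e
  rw [xiSeq_eq_hypersurfaceC, hypersurfaceC_monomial]
  set t := xiIndex p e (1 / (α (Fin.last n) : ℝ))
  have hz : ∏ i, (p ^ e - (t + 1) * α i) = 0 :=
    Finset.prod_eq_zero (Finset.mem_univ (Fin.last n)) (Nat.sub_eq_zero_of_le h2)
  rw [hz, Nat.cast_zero, sub_zero, Fin.prod_univ_castSucc, Nat.cast_mul,
    cast_prod_sub (fun j : Fin n => α j.castSucc)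
      fun j => (Nat.mul_le_mul_left _ (hα (Fin.le_last _))).trans h1, Fintype.card_fin, pow_mul]
  field_simp

theorem tendsto_prod_xiIndex (hpos : 1 ≤ α (Fin.last n)) :
    Tendsto (fun e : ℕ => ∏ j : Fin n,
        (1 - (xiIndex p e (1 / (α (Fin.last n) : ℝ)) : ℝ) / (p : ℝ) ^ e * α j.castSucc))
      atTop (𝓝 (∏ j : Fin n, (1 - 1 / (α (Fin.last n) : ℝ) * α j.castSucc))) := by
  have ha : (0 : ℝ) < α (Fin.last n) := by exact_mod_cast hpos
  have h1 : 1 / (α (Fin.last n) : ℝ) ≤ 1 := by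
    rw [div_le_one ha]; exact_mod_cast hpos
  exact tendsto_finsetProd _ fun j _ => tendsto_const_nhds.sub
    ((tendsto_xiIndex_div (p := p) (by positivity) h1).mul_const _)

/-- The integer factor is at most `a`, and the product tends to zero through its factor at `i`. -/
theorem tendsto_xiSeq_inv_last_of_eq (hα : Monotone α) (hpos : 1 ≤ α (Fin.last n)) {i : Fin n}
    (hi : α i.castSucc = α (Fin.last n)) :
    Tendsto (fun e : ℕ => xiSeq p (∏ i, (MvPowerSeries.X i : MvPowerSeries (Fin (n + 1)) k) ^ α i)
      e (1 / (α (Fin.last n) : ℝ))) atTop (𝓝 0) := by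
  have ha : (0 : ℝ) < α (Fin.last n) := by exact_mod_cast hpos
  have hlim := tendsto_prod_xiIndex (p := p) hpos
  rw [Finset.prod_eq_zero (Finset.mem_univ i) (by rw [hi]; field_simp; ring)] at hlim
  simp only [xiSeq_inv_last hα hpos]
  refine hlim.zero_mul_isBoundedUnder_le ?_ |>.congr fun e => mul_comm _ _
  refine isBoundedUnder_of ⟨α (Fin.last n), fun e => ?_⟩
  have := xiIndex_inv_last_bounds (p := p) hpos e
  rw [Function.comp_apply, Real.norm_of_nonneg (Nat.cast_nonneg _), Nat.cast_le]
  rw [add_mul] at this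
  omega

end Exponents

end Asymptotics

/-! ### Non-reduced quotients have no free Frobenius summands -/

/-- Here `g` acts on `F^e_* S` as `g ^ p ^ e = 0`, but it does not kill a free summand. -/
theorem not_hasFreeSummand_frobeniusPushforward {p : ℕ} [Fact p.Prime] {S : Type u} [CommRing S]
    [CharP S p] {g : S} (hg : g ≠ 0) (hg2 : g ^ 2 = 0) {e : ℕ} (he : e ≠ 0) :
    ¬ HasFreeSummand S (FrobeniusPushforward p e S) := by
  rintro ⟨N, _, _, ⟨φ⟩⟩
  have hpe : 2 ≤ p ^ e := (Fact.out : p.Prime).two_le.trans (Nat.le_self_pow he p)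
  have h0 : ∀ x : FrobeniusPushforward p e S, g • x = 0 := fun x => by
    rw [FrobeniusPushforward.smul_def, pow_eq_zero_of_le hpe hg2, zero_mul]
    rfl
  have h := congrArg φ (h0 (φ.symm (1, 0)))
  rw [map_smul, φ.apply_symm_apply, map_zero] at h
  exact hg (by simpa using congrArg Prod.fst h)

theorem hasFSignature_zero_of_sq_eq_zero {p : ℕ} [Fact p.Prime] {S : Type u} [CommRing S]
    [CharP S p] {g : S} (hg : g ≠ 0) (hg2 : g ^ 2 = 0) : HasFSignature p S 0 := by
  have : Nontrivial S := nontrivial_of_ne _ _ hg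
  -- `F^0_* S` is `S` itself, so the splitting number at `e = 0` is `1`. The numerators vanish
  -- afterwards, so the dimension plays no role.
  refine ⟨inferInstance, fun e => if e = 0 then 1 else 0, fun e => ?_, ?_⟩
  · by_cases he : e = 0
    · subst he
      refine ⟨PUnit.{u + 1}, inferInstance, inferInstance, ⟨?_⟩, ?_⟩
      · let ψ : FrobeniusPushforward p 0 S ≃ₗ[S] S :=
          { toFun := fun x => x
            invFun := fun x => x
            left_inv := fun _ => rfl
            right_inv := fun _ => rfl
            map_add' := fun _ _ => rfl
            map_smul' := fun a x => by
              rw [FrobeniusPushforward.smul_def, pow_zero, pow_one]; rfl }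
        exact ψ.trans ((LinearEquiv.funUnique (Fin 1) S S).symm.trans
          (LinearEquiv.prodUnique (R := S) (M := Fin 1 → S) (M₂ := PUnit.{u + 1})).symm)
      · rintro ⟨N, _, _, ⟨φ⟩⟩
        simpa using congrArg φ (Subsingleton.elim (φ.symm (1, 0)) (φ.symm (0, 0)))
    · simp only [if_neg he]
      refine ⟨FrobeniusPushforward p e S, inferInstance, inferInstance, ⟨?_⟩,
        not_hasFreeSummand_frobeniusPushforward hg hg2 he⟩
      exact (LinearEquiv.uniqueProd (R := S) (M := FrobeniusPushforward p e S)
        (M₂ := Fin 0 → S)).symm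
  · refine tendsto_const_nhds.congr' ?_
    filter_upwards [eventually_ne_atTop 0] with e he
    simp [he]

theorem hasFSignature_quotient_monomial {p : ℕ} [Fact p.Prime] {σ : Type*} [Fintype σ] {k : Type*}
    [Field k] [CharP k p] (α : σ → ℕ) {i : σ} (hi : 2 ≤ α i) :
    HasFSignature p
      (MvPowerSeries σ k ⧸ Ideal.span {(∏ i, MvPowerSeries.X i ^ α i : MvPowerSeries σ k)}) 0 := by
  classical
  set f : MvPowerSeries σ k := ∏ i, MvPowerSeries.X i ^ α i with hf
  -- This is `f / X_i`, still divisible by `X_i` since `α i ≥ 2`; hence `f ∣ g ^ 2` but not `f ∣ g`.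
  set g : MvPowerSeries σ k :=
    MvPowerSeries.X i ^ (α i - 1) * ∏ j ∈ Finset.univ.erase i, MvPowerSeries.X j ^ α j with hg
  have hfg : f = g * MvPowerSeries.X i := by
    rw [hf, ← Finset.mul_prod_erase _ _ (Finset.mem_univ i), hg]
    obtain ⟨m, hm⟩ := Nat.exists_eq_add_of_le' (show 1 ≤ α i by omega)
    rw [hm, Nat.add_sub_cancel, pow_succ]
    ring
  have hXi : ¬ IsUnit (MvPowerSeries.X i : MvPowerSeries σ k) := by
    rw [MvPowerSeries.isUnit_iff_constantCoeff]; simp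
  have hX : ∀ j, (MvPowerSeries.X j : MvPowerSeries σ k) ≠ 0 := fun j h => by
    have := congrArg (MvPowerSeries.coeff (Finsupp.single j 1)) h
    simp [MvPowerSeries.X] at this
  have hg0 : g ≠ 0 :=
    mul_ne_zero (pow_ne_zero _ (hX i)) (Finset.prod_ne_zero_iff.2 fun j _ => pow_ne_zero _ (hX j))
  have hndvd : ¬ f ∣ g := by
    rintro ⟨h, hh⟩
    apply hXi
    refine IsUnit.of_mul_eq_one h (mul_left_cancel₀ hg0 ?_)
    rw [← mul_assoc, ← hfg, ← hh, mul_one]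
  have hdvd : f ∣ g ^ 2 := by
    have : MvPowerSeries.X i ∣ g :=
      Dvd.dvd.mul_right (dvd_pow_self _ (by omega)) _
    rw [hfg, sq]
    exact mul_dvd_mul_left g this
  have hmk : Ideal.Quotient.mk (Ideal.span {f}) g ≠ 0 := by
    rwa [Ne, Ideal.Quotient.eq_zero_iff_mem, Ideal.mem_span_singleton]
  have : Nontrivial (MvPowerSeries σ k ⧸ Ideal.span {f}) := nontrivial_of_ne _ _ hmk
  have : CharP (MvPowerSeries σ k ⧸ Ideal.span {f}) p :=
    charP_of_injective_algebraMap
      (algebraMap k (MvPowerSeries σ k ⧸ Ideal.span {f})).injective p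
  refine hasFSignature_zero_of_sq_eq_zero (g := Ideal.Quotient.mk _ g) hmk ?_
  rw [← map_pow, Ideal.Quotient.eq_zero_iff_mem, Ideal.mem_span_singleton]
  exact hdvd

/-! ### Remainders of prime powers -/

/-- Forward, reduce modulo `q` and cancel the unit `p ^ e`. Backward, the factor `p ^ s` of the
modulus is supplied by `p ^ e`, which requires `s ≤ e`. -/
theorem pow_mod_succ_eq_iff {p s q e : ℕ} (hq : q.Coprime p) (he : s ≤ e) :
    p ^ (e + 1) % (p ^ s * q) = p ^ e % (p ^ s * q) ↔ p ≡ 1 [MOD q] := by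
  have hpow : p ^ (e + 1) = p ^ e * p := pow_succ p e
  constructor
  · intro h
    have h1 : p ^ e * p ≡ p ^ e * 1 [MOD q] := by
      rw [← hpow, mul_one]
      exact Nat.ModEq.of_mul_left (p ^ s) h
    exact Nat.ModEq.cancel_left_of_coprime (hq.pow_right e) h1
  · intro h
    obtain ⟨d, rfl⟩ := Nat.exists_eq_add_of_le he
    have h1 : p ^ s * (p ^ d * p) ≡ p ^ s * (p ^ d * 1) [MOD p ^ s * q] :=
      (h.mul_left (p ^ d)).mul_left' (p ^ s)
    rwa [mul_one, ← mul_assoc, ← pow_add, ← hpow] at h1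

theorem eventually_succ_eq_of_tendsto_natCast {r : ℕ → ℕ} {L : ℝ}
    (h : Tendsto (fun e => (r e : ℝ)) atTop (𝓝 L)) : ∀ᶠ e in atTop, r (e + 1) = r e := by
  have hd : Tendsto (fun e => (r (e + 1) : ℝ) - r e) atTop (𝓝 0) := by
    simpa using (h.comp (tendsto_add_atTop_nat 1)).sub h
  filter_upwards [hd.eventually_lt_const zero_lt_one,
    hd.eventually_const_lt (neg_lt_zero.2 zero_lt_one)] with e h1 h2
  have h1' : (r (e + 1) : ℝ) < (r e + 1 : ℕ) := by push_cast; linarith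
  have h2' : (r e : ℝ) < (r (e + 1) + 1 : ℕ) := by push_cast; linarith
  rw [Nat.cast_lt] at h1' h2'
  omega

/-- A convergent sequence of integers is eventually constant, and one repetition beyond `s` already
forces the congruence. -/
theorem exists_tendsto_pow_mod_iff {p s q : ℕ} (hq : q.Coprime p) :
    (∃ L : ℝ, Tendsto (fun e : ℕ => ((p ^ e % (p ^ s * q) : ℕ) : ℝ)) atTop (𝓝 L)) ↔
      p ≡ 1 [MOD q] := by
  constructor
  · rintro ⟨L, hL⟩
    obtain ⟨e, he, hes⟩ :=
      ((eventually_succ_eq_of_tendsto_natCast hL).and (eventually_ge_atTop s)).exists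
    exact (pow_mod_succ_eq_iff hq hes).1 he
  · intro h
    refine ⟨_, tendsto_const_nhds (x := ((p ^ s % (p ^ s * q) : ℕ) : ℝ)) |>.congr' ?_⟩
    filter_upwards [eventually_ge_atTop s] with e he
    induction e, he using Nat.le_induction with
    | base => rfl
    | succ e he ih => rw [ih, (pow_mod_succ_eq_iff hq he).2 h]

/-! ### The F-pure threshold of a monomial -/

section Main

variable {p : ℕ} [Fact p.Prime] {k : Type u} [Field k] [CharP k p] {n : ℕ}
  {α : Fin (n + 1) → ℕ}

theorem hasFPT_monomial (hα : Monotone α) (hpos : 1 ≤ α (Fin.last n)) :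
    HasFPT p (∏ i, (MvPowerSeries.X i : MvPowerSeries (Fin (n + 1)) k) ^ α i)
      (1 / (α (Fin.last n) : ℝ)) := by
  set a := α (Fin.last n) with ha'
  have ha : (0 : ℝ) < a := by exact_mod_cast hpos
  have hiff : ∀ e t, (∃ i, p ^ e ≤ t * α i) ↔ p ^ e ≤ t * a := fun e t =>
    ⟨fun ⟨i, hi⟩ => hi.trans (Nat.mul_le_mul_left _ (hα (Fin.le_last i))), fun h => ⟨_, h⟩⟩
  -- Together these bounds squeeze `μ_f(p^e) / p^e` between `1/a` and `1/a + 1/p^e`.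
  have hmu : ∀ e, p ^ e ≤
        muF p (∏ i, (MvPowerSeries.X i : MvPowerSeries (Fin (n + 1)) k) ^ α i) e * a ∧
      muF p (∏ i, (MvPowerSeries.X i : MvPowerSeries (Fin (n + 1)) k) ^ α i) e ≤
        p ^ e / a + 1 := by
    intro e
    simp only [muF, pow_mem_frobeniusPower_iff, hiff]
    have hmem : p ^ e / a + 1 ∈ {t : ℕ | 1 ≤ t ∧ p ^ e ≤ t * a} :=
      ⟨Nat.succ_pos _, by rw [mul_comm]; exact (Nat.lt_mul_div_succ _ hpos).le⟩
    exact ⟨(Nat.sInf_mem ⟨_, hmem⟩).2, Nat.sInf_le hmem⟩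
  have hup : Tendsto (fun e : ℕ => 1 / (a : ℝ) + 1 / (p : ℝ) ^ e) atTop (𝓝 (1 / (a : ℝ))) := by
    simpa using (tendsto_const_nhds (x := 1 / (a : ℝ))).add (tendsto_one_div_prime_pow (p := p))
  refine tendsto_of_tendsto_of_tendsto_of_le_of_le tendsto_const_nhds hup (fun e => ?_)
    fun e => ?_
  · have hq := prime_pow_pos (p := p) e
    rw [div_le_div_iff₀ ha hq, one_mul]
    exact_mod_cast (hmu e).1
  · have hq := prime_pow_pos (p := p) e
    have h1 : (muF p (∏ i, (MvPowerSeries.X i : MvPowerSeries (Fin (n + 1)) k) ^ α i) e : ℝ) ≤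
        (p : ℝ) ^ e / a + 1 := by
      refine (Nat.cast_le.2 (hmu e).2).trans ?_
      push_cast
      gcongr
      exact_mod_cast Nat.cast_div_le (α := ℝ) (m := p ^ e) (n := a)
    change _ / (p : ℝ) ^ e ≤ 1 / (a : ℝ) + 1 / (p : ℝ) ^ e
    rw [div_le_iff₀ hq]
    refine h1.trans_eq ?_
    field_simp

/-! ### The function `ξ_f` of a monomial -/

theorem xi_monomial_of_lt (hα : Monotone α) (hpos : 1 ≤ α (Fin.last n)) {x : ℝ} (hx0 : 0 ≤ x)
    (hx : x < 1 / (α (Fin.last n) : ℝ)) :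
    xi p (∏ i, (MvPowerSeries.X i : MvPowerSeries (Fin (n + 1)) k) ^ α i) x =
      volumeDensity α x :=
  (tendsto_xiSeq_of_lt hα hpos hx0 hx).limsup_eq

theorem xi_monomial_of_gt (hpos : 1 ≤ α (Fin.last n)) {x : ℝ}
    (hx : 1 / (α (Fin.last n) : ℝ) < x) (hx1 : x ≤ 1) :
    xi p (∏ i, (MvPowerSeries.X i : MvPowerSeries (Fin (n + 1)) k) ^ α i) x = 0 :=
  (tendsto_const_nhds.congr' ((eventually_xiSeq_eq_zero hpos hx hx1).mono
    fun _ h => h.symm)).limsup_eq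

theorem tendsto_xi_monomial_left (hα : Monotone α) (hpos : 1 ≤ α (Fin.last n)) :
    Tendsto (xi p (∏ i, (MvPowerSeries.X i : MvPowerSeries (Fin (n + 1)) k) ^ α i))
      (𝓝[<] (1 / (α (Fin.last n) : ℝ)))
      (𝓝 (volumeDensity α (1 / (α (Fin.last n) : ℝ)))) := by
  have ha : (0 : ℝ) < α (Fin.last n) := by exact_mod_cast hpos
  refine (((continuous_volumeDensity α).tendsto _).mono_left nhdsWithin_le_nhds).congr' ?_
  filter_upwards [Ioo_mem_nhdsLT (one_div_pos.2 ha)] with x hx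
  exact (xi_monomial_of_lt hα hpos hx.1.le hx.2).symm

theorem continuousOn_xi_monomial (hα : Monotone α) (hpos : 1 ≤ α (Fin.last n)) {i : Fin n}
    (hi : α i.castSucc = α (Fin.last n)) :
    ContinuousOn (xi p (∏ i, (MvPowerSeries.X i : MvPowerSeries (Fin (n + 1)) k) ^ α i))
      (Set.Icc 0 1) := by
  have h0 : volumeDensity α (1 / (α (Fin.last n) : ℝ)) = 0 := by
    rw [volumeDensity_inv_last α hpos i.pos,
      Finset.prod_eq_zero (Finset.mem_univ i) (by rw [hi, sub_self]), mul_zero]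
  have hcont : Continuous fun x : ℝ =>
      if x ≤ 1 / (α (Fin.last n) : ℝ) then volumeDensity α x else 0 :=
    Continuous.if_le (continuous_volumeDensity α) continuous_const continuous_id continuous_const
      fun x hx => by rw [show x = _ from hx, h0]
  refine hcont.continuousOn.congr fun x hx => ?_
  rcases lt_trichotomy x (1 / (α (Fin.last n) : ℝ)) with h | h | h
  · simp only [if_pos h.le, xi_monomial_of_lt hα hpos hx.1 h]
  · simp only [if_pos h.le]
    rw [h, h0]
    exact (tendsto_xiSeq_inv_last_of_eq hα hpos hi).limsup_eq
  · simp only [if_neg h.not_ge, xi_monomial_of_gt hpos h hx.2]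

/-- The left limit at `1/a` is positive and the right limit is zero. The bound `a ≥ 2` puts `1/a`
inside the interval, so that there is a right side. -/
theorem not_continuousOn_xi_monomial (hα : Monotone α) (hpos : 2 ≤ α (Fin.last n)) (hn : 1 ≤ n)
    (hlt : ∀ i : Fin n, α i.castSucc < α (Fin.last n)) :
    ¬ ContinuousOn (xi p (∏ i, (MvPowerSeries.X i : MvPowerSeries (Fin (n + 1)) k) ^ α i))
      (Set.Icc 0 1) := by
  intro hc
  have ha : (0 : ℝ) < α (Fin.last n) := by positivity
  have ha0 : 0 < 1 / (α (Fin.last n) : ℝ) := one_div_pos.2 ha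
  have ha1 : 1 / (α (Fin.last n) : ℝ) < 1 := by
    rw [div_lt_one ha]; exact_mod_cast hpos
  have hpos' : 1 ≤ α (Fin.last n) := by omega
  have hat := (hc.continuousAt (Icc_mem_nhds ha0 ha1)).tendsto
  have hleft := tendsto_nhds_unique (hat.mono_left nhdsWithin_le_nhds)
    (tendsto_xi_monomial_left (p := p) (k := k) hα hpos')
  have hzero : Tendsto (xi p (∏ i, (MvPowerSeries.X i : MvPowerSeries (Fin (n + 1)) k) ^ α i))
      (𝓝[>] (1 / (α (Fin.last n) : ℝ))) (𝓝 0) := by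
    refine tendsto_const_nhds.congr' ?_
    filter_upwards [Ioo_mem_nhdsGT ha1] with x hx
    exact (xi_monomial_of_gt hpos' hx.1 hx.2.le).symm
  have hright := tendsto_nhds_unique (hat.mono_left nhdsWithin_le_nhds) hzero
  have hpositive : 0 < volumeDensity α (1 / (α (Fin.last n) : ℝ)) := by
    rw [volumeDensity_inv_last α hpos' hn]
    exact mul_pos (pow_pos ha0 _) (Finset.prod_pos fun i _ => sub_pos.2 (by exact_mod_cast hlt i))
  exact hpositive.ne' (hleft.symm.trans hright)

/-- The product has a positive limit, so it can be divided out and only the integer factor decides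
convergence. -/
theorem exists_tendsto_xiSeq_inv_last_iff (hα : Monotone α) (hpos : 1 ≤ α (Fin.last n))
    (hlt : ∀ i : Fin n, α i.castSucc < α (Fin.last n)) {s q : ℕ}
    (hsq : α (Fin.last n) = p ^ s * q) (hq : q.Coprime p) :
    (∃ L : ℝ, Tendsto (fun e : ℕ =>
      xiSeq p (∏ i, (MvPowerSeries.X i : MvPowerSeries (Fin (n + 1)) k) ^ α i) e
        (1 / (α (Fin.last n) : ℝ))) atTop (𝓝 L)) ↔ p ≡ 1 [MOD q] := by
  have ha : (0 : ℝ) < α (Fin.last n) := by exact_mod_cast hpos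
  have hprod := tendsto_prod_xiIndex (p := p) hpos
  have hprod_pos : 0 < ∏ j : Fin n, (1 - 1 / (α (Fin.last n) : ℝ) * α j.castSucc) :=
    Finset.prod_pos fun j _ => by
      rw [sub_pos, div_mul_eq_mul_div, one_mul, div_lt_one ha]
      exact_mod_cast hlt j
  simp only [xiSeq_inv_last hα hpos]
  have hiff : (∃ L : ℝ, Tendsto (fun e : ℕ =>
      ((p ^ e - xiIndex p e (1 / (α (Fin.last n) : ℝ)) * α (Fin.last n) : ℕ) : ℝ)) atTop (𝓝 L)) ↔
        p ≡ 1 [MOD q] := by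
    rcases hpos.eq_or_lt with h1 | h1
    -- For `a = 1` the integer factor is constantly `1`, not the remainder `p ^ e % 1 = 0`, because
    -- the index at `x = 1` is `p ^ e - 1`.
    · have hq1 : q = 1 := Nat.eq_one_of_mul_eq_one_left (hsq.symm.trans h1.symm)
      refine iff_of_true ⟨1, tendsto_const_nhds.congr fun e => ?_⟩ (by rw [hq1]; exact Nat.modEq_one)
      have := Nat.one_le_pow e _ (Fact.out : p.Prime).pos
      rw [← h1, Nat.cast_one, div_one, xiIndex, if_neg (lt_irrefl _), mul_one,
        Nat.sub_sub_self this, Nat.cast_one]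
    · have hlt1 : 1 / (α (Fin.last n) : ℝ) < 1 := by
        rw [div_lt_one ha]; exact_mod_cast h1
      rw [← exists_tendsto_pow_mod_iff (s := s) hq, ← hsq]
      have hmod : ∀ e, p ^ e - xiIndex p e (1 / (α (Fin.last n) : ℝ)) * α (Fin.last n) =
          p ^ e % α (Fin.last n) := fun e => by
        rw [xiIndex, if_pos hlt1, div_mul_eq_mul_div, one_mul, ← Nat.cast_pow,
          Nat.floor_div_eq_div, Nat.mod_eq_sub_div_mul]
      simp only [hmod]
  rw [← hiff]
  constructor
  · rintro ⟨L, hL⟩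
    refine ⟨_, (hL.div hprod hprod_pos.ne').congr' ?_⟩
    filter_upwards [hprod.eventually_const_lt hprod_pos] with e he
    rw [Pi.div_apply, mul_div_cancel_right₀ _ he.ne']
  · rintro ⟨L, hL⟩
    exact ⟨_, hL.mul hprod⟩

end Main

theorem proposition3p1 {p : ℕ} [Fact p.Prime] {k : Type u} [Field k] [CharP k p] [PerfectField k]
    {n : ℕ} (hn : 1 ≤ n) (α : Fin (n + 1) → ℕ) (hα : Monotone α) (hpos : 1 ≤ α (Fin.last n))
    (f : MvPowerSeries (Fin (n + 1)) k) (hf : f = ∏ i, MvPowerSeries.X i ^ α i) :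
    -- 1)
    HasFPT p f (1 / (α (Fin.last n) : ℝ)) ∧
    (2 ≤ α (Fin.last n) →
      HasFSignature p (MvPowerSeries (Fin (n + 1)) k ⧸ Ideal.span {f}) 0) ∧
    -- 2)
    Tendsto (xi p f) (𝓝[<] (1 / (α (Fin.last n) : ℝ)))
      (𝓝 ((1 / (α (Fin.last n) : ℝ)) ^ (n - 1) *
        ∏ j : Fin n, ((α (Fin.last n) : ℝ) - (α j.castSucc : ℝ)))) ∧
    0 ≤ (1 / (α (Fin.last n) : ℝ)) ^ (n - 1) *
        ∏ j : Fin n, ((α (Fin.last n) : ℝ) - (α j.castSucc : ℝ)) ∧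
    -- 3)
    (f ≠ MvPowerSeries.X (Fin.last n) →
      (ContinuousOn (xi p f) (Set.Icc 0 1) ↔ α ⟨n - 1, by omega⟩ = α (Fin.last n))) ∧
    -- 4)
    (∀ s q : ℕ, α (Fin.last n) = p ^ s * q → q.Coprime p →
      ((∃ L : ℝ, Tendsto (fun e : ℕ => xiSeq p f e (1 / (α (Fin.last n) : ℝ))) atTop (𝓝 L)) ↔
        (α ⟨n - 1, by omega⟩ = α (Fin.last n) ∨ p ≡ 1 [MOD q]))) := by
  subst hf
  have hle : ∀ i : Fin n, α i.castSucc ≤ α ⟨n - 1, by omega⟩ := fun i =>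
    hα (Fin.mk_le_mk.2 (by omega))
  have hlast : α ⟨n - 1, by omega⟩ ≤ α (Fin.last n) := hα (Fin.le_last _)
  have hlt_of_ne : α ⟨n - 1, by omega⟩ ≠ α (Fin.last n) →
      ∀ i : Fin n, α i.castSucc < α (Fin.last n) := fun hne i =>
    (hle i).trans_lt (lt_of_le_of_ne hlast hne)
  refine ⟨hasFPT_monomial hα hpos, hasFSignature_quotient_monomial α, ?_, ?_, fun hX => ?_,
    fun s q hsq hq => ?_⟩
  · rw [← volumeDensity_inv_last α hpos hn]
    exact tendsto_xi_monomial_left hα hpos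
  · refine mul_nonneg (by positivity) (Finset.prod_nonneg fun i _ => sub_nonneg.2 ?_)
    exact_mod_cast (hle i).trans hlast
  · refine ⟨fun hc => ?_, fun h =>
      continuousOn_xi_monomial hα hpos (i := ⟨n - 1, by omega⟩) h⟩
    by_contra hne
    have hlt := hlt_of_ne hne
    -- If `a = 1`, the strict inequalities make all other exponents zero, which is the excluded case
    -- of a single variable.
    rcases hpos.eq_or_lt with h1 | h1
    · apply hX
      rw [Fin.prod_univ_castSucc, ← h1, pow_one, Finset.prod_eq_one, one_mul]
      intro i _
      have := hlt i
      rw [show α i.castSucc = 0 by omega, pow_zero]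
    · exact not_continuousOn_xi_monomial hα h1 hn hlt hc
  · by_cases hne : α ⟨n - 1, by omega⟩ = α (Fin.last n)
    · exact iff_of_true
        ⟨0, tendsto_xiSeq_inv_last_of_eq hα hpos (i := ⟨n - 1, by omega⟩) hne⟩ (Or.inl hne)
    · rw [exists_tendsto_xiSeq_inv_last_iff hα hpos (hlt_of_ne hne) hsq hq]
      exact (or_iff_right hne).symm
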